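/- Write $\binom{\alpha}{\beta}\to\binom{\gamma\ \ \varepsilon}{\delta\ \ \zeta}$ for order types $\alpha,\beta,\gamma,\delta,\varepsilon,\zeta$ if for every linearly ordered set $A$ of order type $\alpha$, every linearly ordered set $B$ of order type $\beta$ and every colouring $c\colon A\times B\to\{0,1\}$, either there are $C\subseteq A$ of order type $\gamma$ and $D\subseteq B$ of order type $\delta$ with $c[C\times D]\subseteq\{0\}$, or there are $E\subseteq A$ of order type $\varepsilon$ and $Z\subseteq B$ of order type $\zeta$ with $c[E\times Z]\subseteq\{1\}$. (Subsets carry the induced order.) Then for every natural number $k$, $$\binom{\omega^\omega}{\omega^\omega}\longrightarrow\binom{\omega^\omega\ \ k}{\omega^\omega\ \ k},$$ where $\omega^\omega$ denotes ordinal exponentiation and ordinals stand for their order types. -/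

import Mathlib

universe u

/-- The order type of an ordinal. -/
noncomputable def Ordinal.toOrderType (o : Ordinal.{u}) : OrderType.{u} :=
  OrderType.type o.ToType

/-- The polarised partition relation `(α over β) → (γ ε over δ ζ)` for order types,
written with the two targets for colour `0` (`γ`, `δ`) before those for colour `1` (`ε`, `ζ`): for all linearly
ordered sets `A` of type `α` and `B` of type `β` and every colouring `c : A × B → {0, 1}`, either
there are `C ⊆ A` of type `γ` and `D ⊆ B` of type `δ` such that `c` is constantly `0` on `C × D`, or
there are `E ⊆ A` of type `ε` and `Z ⊆ B` of type `ζ` such that `c` is constantly `1` on `E × Z`.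
Subsets carry the induced order. -/
def PolarisedArrow (α β γ δ ε ζ : OrderType.{u}) : Prop :=
  ∀ (A B : Type u) [LinearOrder A] [LinearOrder B],
    OrderType.type A = α → OrderType.type B = β →
    ∀ c : A × B → Fin 2,
      (∃ (C : Set A) (D : Set B), OrderType.type C = γ ∧ OrderType.type D = δ ∧
        c '' (C ×ˢ D) ⊆ {0}) ∨
      (∃ (E : Set A) (Z : Set B), OrderType.type E = ε ∧ OrderType.type Z = ζ ∧
        c '' (E ×ˢ Z) ⊆ {1})

open Filter

/-! Let `E` be colour 1, transported to ordinals below `ω ^ ω`, and suppose it contains no complete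
bipartite `k` by `k` graph. Then ultrafilter quantifiers over `¬ E` commute
(`CompleteFree.eventually_comm`). View `ω ^ ω` as a tree of intervals of length `ω ^ n`, each node
carrying the iterated limit of its children's ultrafilters. Generic non-adjacency holds at the pair
of roots and, by commutation, passes to most children on either side, so two infinitely branching
subtrees can be grown that keep it for all pairs of nodes (`CompleteFree.exists_subtrees`). Leaves
carry principal ultrafilters, so there it is true non-adjacency, and the leaves of such a subtree
have type `ω ^ ω` (`type_leaves`). -/

namespace BipartiteUltrafilter

/-- The relation `E` contains no complete bipartite graph with `k` vertices on either side. -/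
def CompleteFree {X Y : Type*} (E : X → Y → Prop) (k : ℕ) : Prop :=
  ∀ (P : Finset X) (Q : Finset Y), P.card = k → Q.card = k → ∃ x ∈ P, ∃ y ∈ Q, ¬ E x y

theorem CompleteFree.flip {X Y : Type*} {E : X → Y → Prop} {k : ℕ} (h : CompleteFree E k) :
    CompleteFree (fun y x => E x y) k := by
  intro P Q hP hQ
  obtain ⟨x, hx, y, hy, hxy⟩ := h Q P hQ hP
  exact ⟨y, hy, x, hx, hxy⟩

theorem eq_pure_or_infinite {X : Type*} (W : Ultrafilter X) :
    (∃ x, W = pure x) ∨ ∀ s ∈ W, s.Infinite := by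
  by_cases h : ∃ s ∈ W, s.Finite
  · obtain ⟨s, hs, hf⟩ := h
    obtain ⟨x, -, hx⟩ := Ultrafilter.eq_pure_of_finite_mem hf hs
    exact Or.inl ⟨x, hx⟩
  · exact Or.inr fun s hs hf => h ⟨s, hs, hf⟩

/-- Otherwise almost every `x` is adjacent to almost every `y`. Any `k` such `x` then have a common
neighbourhood in `W'`, which is infinite and so supplies `k` vertices `y`. -/
theorem CompleteFree.eventually_not {X Y : Type*} {E : X → Y → Prop} {k : ℕ}
    (h : CompleteFree E k) {W : Ultrafilter X} {W' : Ultrafilter Y}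
    (hW : ∀ s ∈ W, s.Infinite) (hW' : ∀ s ∈ W', s.Infinite) :
    ∀ᶠ x in W, ∀ᶠ y in W', ¬ E x y := by
  by_contra hn
  rw [← Ultrafilter.frequently_iff_eventually, not_frequently] at hn
  simp only [Ultrafilter.eventually_not, not_not] at hn
  obtain ⟨P, hP, hPk⟩ := (hW _ hn).exists_subset_card_eq k
  have hall : ∀ᶠ y in W', ∀ x ∈ P, E x y :=
    (Finset.eventually_all P).2 fun x hx => hP hx
  obtain ⟨Q, hQ, hQk⟩ := (hW' _ hall).exists_subset_card_eq k
  obtain ⟨x, hx, y, hy, hxy⟩ := h P Q hPk hQk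
  exact hxy (hQ hy x hx)

/-- For a relation without large complete bipartite subgraphs, two ultrafilter quantifiers commute
on its complement. -/
theorem CompleteFree.eventually_comm {X Y : Type*} {E : X → Y → Prop} {k : ℕ}
    (h : CompleteFree E k) {W : Ultrafilter X} {W' : Ultrafilter Y} :
    (∀ᶠ x in W, ∀ᶠ y in W', ¬ E x y) ↔ ∀ᶠ y in W', ∀ᶠ x in W, ¬ E x y := by
  rcases eq_pure_or_infinite W with ⟨a, rfl⟩ | hW
  · simp
  rcases eq_pure_or_infinite W' with ⟨b, rfl⟩ | hW'
  · simp
  exact iff_of_true (h.eventually_not hW hW') (h.flip.eventually_not hW' hW)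

/-- A node reached from `root` by following a list of child indices. -/
def descendant {ν : Type*} (child : ν → ℕ → ν) (root : ν) (l : List ℕ) : ν :=
  l.foldr (fun i s => child s i) root

/-- Finite approximations to a pair of subtrees all of whose nodes are related by `R`. -/
abbrev RelatedPair {ν : Type*} (R : ν → ν → Prop) : Type _ :=
  {p : Set ν × Set ν // p.1.Finite ∧ p.2.Finite ∧ ∀ s ∈ p.1, ∀ t ∈ p.2, R s t}

/-- The cofinal set of all `p` that lie in `B` or have no extension in `A`, if every element of `A`
has an extension in `B`. -/
def cofinalOfExtension {P : Type*} [Preorder P] (A B : Set P) (h : ∀ p ∈ A, ∃ q ∈ B, p ≤ q) :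
    Order.Cofinal P where
  carrier := {p | (∀ q ≥ p, q ∉ A) ∨ p ∈ B}
  isCofinal := by
    intro p
    by_cases hp : ∀ q ≥ p, q ∉ A
    · exact ⟨p, Or.inl hp, le_rfl⟩
    · push Not at hp
      obtain ⟨q, hpq, hq⟩ := hp
      obtain ⟨r, hr, hqr⟩ := h q hq
      exact ⟨r, Or.inr hr, hpq.trans hqr⟩

/-- A Rasiowa–Sikorski argument for conditional requirements. Since `A a` is upward closed,
directedness rules out meeting the cofinal set through an element with no extension in `A a`. -/
theorem exists_ideal_of_extensions {P ι : Type*} [Preorder P] [Encodable ι] (p₀ : P)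
    (A B : ι → Set P) (hA : ∀ a p q, p ≤ q → p ∈ A a → q ∈ A a)
    (h : ∀ a, ∀ p ∈ A a, ∃ q ∈ B a, p ≤ q) :
    ∃ I : Order.Ideal P, p₀ ∈ I ∧ ∀ a, (∃ p ∈ I, p ∈ A a) → ∃ p ∈ I, p ∈ B a := by
  let 𝒟 := fun a => cofinalOfExtension (A a) (B a) (h a)
  refine ⟨Order.idealOfCofinals p₀ 𝒟, Order.mem_idealOfCofinals p₀ 𝒟, ?_⟩
  rintro a ⟨p, hp, hpA⟩
  obtain ⟨q, hq | hq, hqI⟩ := Order.cofinal_meets_idealOfCofinals p₀ 𝒟 a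
  · obtain ⟨r, -, hpr, hqr⟩ := (Order.idealOfCofinals p₀ 𝒟).directed p hp q hqI
    exact absurd (hA a p r hpr hpA) (hq r hqr)
  · exact ⟨q, hqI, hq⟩

theorem exists_related_subtrees {ν : Type*} (child : ν → ℕ → ν) (root : ν) (R : ν → ν → Prop)
    {U : Filter ℕ} [U.NeBot] (hU : U ≤ atTop) (hroot : R root root)
    (hl : ∀ s t, R s t → ∀ᶠ i in U, R (child s i) t)
    (hr : ∀ s t, R s t → ∀ᶠ i in U, R s (child t i)) :
    ∃ S T : Set ν, root ∈ S ∧ root ∈ T ∧ (∀ s ∈ S, ∃ᶠ i in atTop, child s i ∈ S) ∧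
      (∀ t ∈ T, ∃ᶠ i in atTop, child t i ∈ T) ∧ ∀ s ∈ S, ∀ t ∈ T, R s t := by
  let node := descendant child root
  let p₀ : RelatedPair R := ⟨({root}, {root}), Set.finite_singleton _, Set.finite_singleton _, by
    rintro s rfl t rfl
    exact hroot⟩
  -- Requirement `(l, N)`: once `node l` is present, so is a child of index at least `N`. Indexing
  -- by lists keeps the requirements countable even if `ν` is not.
  obtain ⟨I, hp₀, hI⟩ := exists_ideal_of_extensions (ι := (List ℕ × ℕ) ⊕ (List ℕ × ℕ)) p₀
    (Sum.elim (fun a => {p | node a.1 ∈ p.1.1}) (fun a => {p | node a.1 ∈ p.1.2}))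
    (Sum.elim (fun a => {p | ∃ i ≥ a.2, node (i :: a.1) ∈ p.1.1})
      (fun a => {p | ∃ i ≥ a.2, node (i :: a.1) ∈ p.1.2}))
    (by
      rintro (a | a) p q hpq hp
      exacts [hpq.1 hp, hpq.2 hp])
    (by
      rintro (a | a) ⟨⟨p, q⟩, hp, hq, hpq⟩ hs
      -- The other side is finite, so a new child faces only finitely many `U`-large conditions.
      · obtain ⟨i, hi, hia⟩ := ((hq.eventually_all.2 fun t ht => hl _ t (hpq _ hs t ht)).and
          (hU (eventually_ge_atTop a.2))).exists
        refine ⟨⟨⟨insert (child (node a.1) i) p, q⟩, hp.insert _, hq, ?_⟩,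
          ⟨i, hia, Set.mem_insert _ _⟩, Set.subset_insert _ _, subset_rfl⟩
        rintro s (rfl | hs) t ht
        exacts [hi t ht, hpq s hs t ht]
      · obtain ⟨i, hi, hia⟩ := ((hp.eventually_all.2 fun s hs' => hr s _ (hpq s hs' _ hs)).and
          (hU (eventually_ge_atTop a.2))).exists
        refine ⟨⟨⟨p, insert (child (node a.1) i) q⟩, hp, hq.insert _, ?_⟩,
          ⟨i, hia, Set.mem_insert _ _⟩, subset_rfl, Set.subset_insert _ _⟩
        rintro s hs t (rfl | ht)
        exacts [hi s hs, hpq s hs t ht])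
  refine ⟨{s | ∃ l, s = node l ∧ ∃ p ∈ I, s ∈ p.1.1}, {s | ∃ l, s = node l ∧ ∃ p ∈ I, s ∈ p.1.2},
    ⟨[], rfl, p₀, hp₀, rfl⟩, ⟨[], rfl, p₀, hp₀, rfl⟩, ?_, ?_, ?_⟩
  · rintro s ⟨l, rfl, hs⟩
    refine frequently_atTop.2 fun N => ?_
    obtain ⟨p, hp, i, hi, hpi⟩ := hI (Sum.inl (l, N)) hs
    exact ⟨i, hi, i :: l, rfl, p, hp, hpi⟩
  · rintro s ⟨l, rfl, hs⟩
    refine frequently_atTop.2 fun N => ?_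
    obtain ⟨p, hp, i, hi, hpi⟩ := hI (Sum.inr (l, N)) hs
    exact ⟨i, hi, i :: l, rfl, p, hp, hpi⟩
  · rintro s ⟨-, -, p, hp, hs⟩ t ⟨-, -, q, hq, ht⟩
    obtain ⟨r, -, hpr, hqr⟩ := I.directed p hp q hq
    exact r.2.2.2 s (hpr.1 hs) t (hqr.2 ht)

/-- If `E` has no large complete bipartite subgraph, a tree of ultrafilters with a nonprincipal root
has two infinitely branching subtrees all of whose nodes are generically non-adjacent. -/
theorem CompleteFree.exists_subtrees {X ν : Type*} {E : X → X → Prop} {k : ℕ}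
    (h : CompleteFree E k) (child : ν → ℕ → ν) (root : ν) (W : ν → Ultrafilter X)
    (hW : ∀ s (p : X → Prop), (∀ᶠ x in W s, p x) →
      ∀ᶠ i in hyperfilter ℕ, ∀ᶠ x in W (child s i), p x)
    (hroot : ∀ s ∈ W root, s.Infinite) :
    ∃ S T : Set ν, root ∈ S ∧ root ∈ T ∧ (∀ s ∈ S, ∃ᶠ i in atTop, child s i ∈ S) ∧
      (∀ t ∈ T, ∃ᶠ i in atTop, child t i ∈ T) ∧
      ∀ s ∈ S, ∀ t ∈ T, ∀ᶠ x in W s, ∀ᶠ y in W t, ¬ E x y := by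
  refine exists_related_subtrees child root (fun s t => ∀ᶠ x in W s, ∀ᶠ y in W t, ¬ E x y)
    Nat.hyperfilter_le_atTop (h.eventually_not hroot hroot) (fun s t hst => hW s _ hst) ?_
  intro s t hst
  -- Commuting brings `W t` outermost, where `hW` applies.
  filter_upwards [hW t _ (h.eventually_comm.1 hst)] with i hi
  exact h.eventually_comm.2 hi

open Ordinal

/-- The `i`-th child of a node: `none` is the root, `some (α, n)` stands for the interval of length
`ω ^ n` starting at `α`. Singleton intervals are their own children. -/
noncomputable def intervalChild : Option (Ordinal.{u} × ℕ) → ℕ → Option (Ordinal.{u} × ℕ)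
  | none, i => some (ω ^ i, i)
  | some (α, 0), _ => some (α, 0)
  | some (α, n + 1), i => some (α + ω ^ n * i, n)

/-- An iterated ultrafilter limit on the interval of length `ω ^ n` starting at `α`. -/
noncomputable def intervalUltrafilter : ℕ → Ordinal.{u} → Ultrafilter Ordinal.{u}
  | 0, α => pure α
  | n + 1, α => (hyperfilter ℕ).bind fun i => intervalUltrafilter n (α + ω ^ n * i)

/-- The ultrafilter attached to a node. -/
noncomputable def nodeUltrafilter : Option (Ordinal.{u} × ℕ) → Ultrafilter Ordinal.{u}
  | none => (hyperfilter ℕ).bind fun i => intervalUltrafilter i (ω ^ i)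
  | some (α, n) => intervalUltrafilter n α

theorem eventually_nodeUltrafilter_child (s : Option (Ordinal.{u} × ℕ)) (p : Ordinal.{u} → Prop)
    (h : ∀ᶠ x in nodeUltrafilter s, p x) :
    ∀ᶠ i in hyperfilter ℕ, ∀ᶠ x in nodeUltrafilter (intervalChild s i), p x := by
  match s, h with
  | none, h => exact h
  | some (α, 0), h => exact Eventually.of_forall fun _ => h
  | some (α, n + 1), h => exact h

theorem pow_mul_natCast_add (n i : ℕ) :
    ω ^ n * (i : Ordinal.{u}) + ω ^ n = ω ^ n * (i + 1 : ℕ) := by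
  rw [Nat.cast_add, mul_add, Nat.cast_one, mul_one]

theorem interval_child_bound (α x : Ordinal.{u}) (n i : ℕ)
    (h : α + ω ^ n * i ≤ x ∧ x < α + ω ^ n * i + ω ^ n) : α ≤ x ∧ x < α + ω ^ (n + 1) := by
  refine ⟨le_self_add.trans h.1, h.2.trans_le ?_⟩
  rw [add_assoc, pow_mul_natCast_add, pow_succ]
  gcongr
  exact (natCast_lt_omega0 _).le

theorem eventually_intervalUltrafilter_mem (n : ℕ) (α : Ordinal.{u}) :
    ∀ᶠ x in intervalUltrafilter n α, α ≤ x ∧ x < α + ω ^ n := by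
  induction n generalizing α with
  | zero =>
    change α ≤ α ∧ α < α + ω ^ 0
    simp
  | succ n ih =>
    change ∀ᶠ i : ℕ in hyperfilter ℕ, ∀ᶠ x in intervalUltrafilter n (α + ω ^ n * i),
      α ≤ x ∧ x < α + ω ^ (n + 1)
    exact Eventually.of_forall fun i => (ih _).mono fun x hx => interval_child_bound α x n i hx

theorem pow_add_pow_le (n : ℕ) : (ω : Ordinal.{u}) ^ n + ω ^ n ≤ ω ^ (n + 1) := by
  have h1 := pow_mul_natCast_add.{u} n 1
  rw [Nat.cast_one, mul_one] at h1
  rw [h1, pow_succ]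
  gcongr
  exact (natCast_lt_omega0 _).le

/-- A principal root ultrafilter would put its point in `[ω ^ i, ω ^ (i + 1))` for infinitely many
`i`, but these intervals are disjoint. -/
theorem infinite_of_mem_nodeUltrafilter_none (s : Set Ordinal.{u})
    (hs : s ∈ nodeUltrafilter.{u} none) : s.Infinite := by
  intro hf
  obtain ⟨x, -, hx⟩ := Ultrafilter.eq_pure_of_finite_mem hf hs
  have hmem : ∀ᶠ y in nodeUltrafilter.{u} none, y = x := by
    rw [hx]
    exact eventually_pure.2 rfl
  have h1 : ∀ᶠ i in hyperfilter ℕ, ω ^ i ≤ x ∧ x < ω ^ (i + 1) := by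
    have h2 : ∀ᶠ i in hyperfilter ℕ, ∀ᶠ y in intervalUltrafilter i (ω ^ i), y = x := hmem
    filter_upwards [h2] with i hi
    obtain ⟨y, rfl, hy⟩ := (hi.and (eventually_intervalUltrafilter_mem i (ω ^ i))).exists
    exact ⟨hy.1, hy.2.trans_le (pow_add_pow_le i)⟩
  obtain ⟨i, hi⟩ := h1.exists
  obtain ⟨j, hj, hij⟩ := (h1.and (Nat.hyperfilter_le_atTop (eventually_ge_atTop (i + 1)))).exists
  exact absurd (hi.2.trans_le ((pow_le_pow_right₀ one_lt_omega0.le hij).trans hj.1)) (lt_irrefl _)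

/-- Below a node `(α, n)` of an infinitely branching subtree the leaves contain a copy of `ω ^ n`. -/
theorem exists_strictMonoOn_leaves {S : Set (Option (Ordinal.{u} × ℕ))}
    (hS : ∀ s ∈ S, ∃ᶠ i in atTop, intervalChild s i ∈ S) (n : ℕ) (α : Ordinal.{u})
    (h : some (α, n) ∈ S) :
    ∃ f : Ordinal.{u} → Ordinal.{u}, StrictMonoOn f (Set.Iio (ω ^ n)) ∧
      ∀ x < ω ^ n, some (f x, 0) ∈ S ∧ α ≤ f x ∧ f x < α + ω ^ n := by
  induction n generalizing α with
  | zero =>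
    refine ⟨fun _ => α, ?_, fun x _ => ⟨h, le_rfl, by simp⟩⟩
    intro x hx y hy hxy
    simp only [pow_zero, Set.mem_Iio, Order.lt_one_iff] at hx hy
    simp [hx, hy] at hxy
  | succ n ih =>
    obtain ⟨φ, hφ, hφS⟩ := extraction_of_frequently_atTop (hS _ h)
    choose f hf hfS using fun q => ih _ (hφS q)
    have hω : (ω : Ordinal.{u}) ^ n ≠ 0 := pow_ne_zero _ omega0_ne_zero
    have hdiv : ∀ x < (ω : Ordinal.{u}) ^ (n + 1), ∃ q : ℕ, x / ω ^ n = q := fun x hx => by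
      rw [pow_succ, lt_mul_iff_div_lt hω] at hx
      exact lt_omega0.1 hx
    choose! q hq using hdiv
    -- Writing `x = ω ^ n * q + r`, send `x` to the leaf numbered `r` below the surviving child
    -- numbered `q`, whose index is `φ q`.
    refine ⟨fun x => f (q x) (x % ω ^ n), ?_, fun x hx => ?_⟩
    · intro x hx y hy hxy
      have hxq := hq x hx
      have hyq := hq y hy
      have hqle : q x ≤ q y := by
        have h1 : (q x : Ordinal.{u}) ≤ q y := by
          rw [← hyq, ← mul_le_iff_le_div hω, ← hxq]
          exact (mul_div_le x _).trans hxy.le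
        exact_mod_cast h1
      have hxm := mod_lt x hω
      have hym := mod_lt y hω
      rcases hqle.eq_or_lt with he | hlt
      · simp only [he]
        refine hf _ hxm hym ?_
        have h1 := div_add_mod x (ω ^ n)
        have h2 := div_add_mod y (ω ^ n)
        rw [hxq, he] at h1
        rw [hyq] at h2
        exact lt_of_add_lt_add_left (h1.trans_lt (hxy.trans_eq h2.symm))
      · refine (hfS _ _ hxm).2.2.trans_le (le_trans ?_ (hfS _ _ hym).2.1)
        rw [add_assoc]
        gcongr
        rw [pow_mul_natCast_add]
        gcongr
        exact_mod_cast hφ hlt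
    · obtain ⟨h1, h2⟩ := hfS (q x) _ (mod_lt x hω)
      exact ⟨h1, interval_child_bound α _ n _ h2⟩

/-- The leaves of an infinitely branching subtree containing the root have order type `ω ^ ω`. -/
theorem type_leaves {A : Type u} [LinearOrder A] (g : A ≃o Set.Iio (ω ^ ω : Ordinal.{u}))
    {S : Set (Option (Ordinal.{u} × ℕ))}
    (hS : ∀ s ∈ S, ∃ᶠ i in atTop, intervalChild s i ∈ S) (hroot : none ∈ S) :
    Nonempty ({a : A | some ((g a : Ordinal.{u}), 0) ∈ S} ≃o (ω ^ ω : Ordinal.{u}).ToType) := by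
  set C : Set A := {a : A | some ((g a : Ordinal.{u}), 0) ∈ S}
  let e : A ≃o (ω ^ ω : Ordinal.{u}).ToType := g.trans ToType.mk
  have : WellFoundedLT A := e.toOrderEmbedding.wellFoundedLT
  have hlow : ∀ n : ℕ, ω ^ n ≤ Ordinal.type (α := C) (· < ·) := by
    intro n
    obtain ⟨m, hm, hmS⟩ := (frequently_atTop.1 (hS _ hroot)) n
    refine (pow_le_pow_right₀ one_lt_omega0.le hm).trans ?_
    obtain ⟨f, hf, hfS⟩ := exists_strictMonoOn_leaves hS m _ hmS
    have hlt : ∀ x < (ω : Ordinal.{u}) ^ m, f x < ω ^ (ω : Ordinal.{u}) := fun x hx => by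
      refine ((hfS x hx).2.2.trans_le (pow_add_pow_le m)).trans ?_
      rw [← opow_natCast]
      exact (opow_lt_opow_iff_right one_lt_omega0).2 (natCast_lt_omega0 _)
    let F : (ω ^ m : Ordinal.{u}).ToType → C := fun x =>
      ⟨g.symm ⟨f x.toOrd, hlt _ x.toOrd.2⟩, by
        change some (((g (g.symm _) : Set.Iio _) : Ordinal.{u}), 0) ∈ S
        rw [g.apply_symm_apply]
        exact (hfS _ x.toOrd.2).1⟩
    have hF : StrictMono F := fun x y hxy => by
      refine g.symm.strictMono ?_
      exact hf x.toOrd.2 y.toOrd.2 (ToType.mk.symm.strictMono hxy)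
    rw [← type_toType (ω ^ m : Ordinal.{u})]
    exact type_le_iff'.2 ⟨(OrderEmbedding.ofStrictMono F hF).ltEmbedding⟩
  have hle : ω ^ ω ≤ Ordinal.type (α := C) (· < ·) := by
    rw [opow_le_of_isSuccLimit omega0_ne_zero isSuccLimit_omega0]
    intro b hb
    obtain ⟨n, rfl⟩ := lt_omega0.1 hb
    rw [opow_natCast]
    exact hlow n
  have hge : Ordinal.type (α := C) (· < ·) ≤ ω ^ ω := by
    rw [← type_toType (ω ^ ω : Ordinal.{u})]
    exact type_le_iff'.2 ⟨(OrderEmbedding.ofStrictMono (fun a : C => e a) fun a b h => e.strictMono h).ltEmbedding⟩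
  have heq := (hge.antisymm hle).trans (type_toType (ω ^ ω : Ordinal.{u})).symm
  exact (type_eq.1 heq).map OrderIso.ofRelIsoLT

/-- A finite set of ordinals of cardinality `k` pulls back to a set of order type `k`. -/
theorem type_preimage_finset {A : Type u} [LinearOrder A] {o : Ordinal.{u}} (g : A ≃o Set.Iio o)
    (P : Finset Ordinal.{u}) {k : ℕ} (hP : P.card = k) (hPo : ∀ x ∈ P, x < o) :
    OrderType.type {a : A | (g a : Ordinal.{u}) ∈ P} = (k : Ordinal.{u}).toOrderType := by
  let e : {a : A | (g a : Ordinal.{u}) ∈ P} ≃ P :=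
    { toFun := fun a => ⟨g a.1, a.2⟩
      invFun := fun x => ⟨g.symm ⟨x.1, hPo _ x.2⟩, by simp⟩
      left_inv := fun a => Subtype.ext (g.symm_apply_apply a.1)
      right_inv := fun x => by simp }
  have : Fintype {a : A | (g a : Ordinal.{u}) ∈ P} := Fintype.ofEquiv _ e.symm
  have h1 : Fintype.card {a : A | (g a : Ordinal.{u}) ∈ P} = k := by
    rw [Fintype.card_congr e, Fintype.card_coe, hP]
  have : Finite (k : Ordinal.{u}).ToType := by
    rw [← Cardinal.lt_aleph0_iff_finite]
    simp
  have : Fintype (k : Ordinal.{u}).ToType := Fintype.ofFinite _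
  have h2 : Fintype.card (k : Ordinal.{u}).ToType = k := by
    have := Cardinal.mk_fintype (k : Ordinal.{u}).ToType
    simp only [Cardinal.mk_toType, Ordinal.card_nat] at this
    exact_mod_cast this.symm
  exact OrderType.type_congr
    ((Fintype.orderIsoFinOfCardEq _ h1).symm.trans (Fintype.orderIsoFinOfCardEq _ h2))

end BipartiteUltrafilter

open Filter BipartiteUltrafilter Ordinal in
theorem proposition5p8 (k : ℕ) :
    PolarisedArrow
      (Ordinal.omega0.{u} ^ Ordinal.omega0.{u}).toOrderType
      (Ordinal.omega0.{u} ^ Ordinal.omega0.{u}).toOrderType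
      (Ordinal.omega0.{u} ^ Ordinal.omega0.{u}).toOrderType
      (Ordinal.omega0.{u} ^ Ordinal.omega0.{u}).toOrderType
      (k : Ordinal.{u}).toOrderType
      (k : Ordinal.{u}).toOrderType := by
  intro A B _ _ hA hB c
  obtain ⟨eA⟩ := OrderType.type_eq_type.1 hA
  obtain ⟨eB⟩ := OrderType.type_eq_type.1 hB
  let gA : A ≃o Set.Iio (ω ^ ω : Ordinal.{u}) := eA.trans ToType.mk.symm
  let gB : B ≃o Set.Iio (ω ^ ω : Ordinal.{u}) := eB.trans ToType.mk.symm
  let E : Ordinal.{u} → Ordinal.{u} → Prop := fun x y => ∃ a b, gA a = x ∧ gB b = y ∧ c (a, b) = 1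
  by_cases h : CompleteFree E k
  · left
    obtain ⟨S, T, hS, hT, hSc, hTc, hST⟩ := h.exists_subtrees intervalChild none nodeUltrafilter
      eventually_nodeUltrafilter_child infinite_of_mem_nodeUltrafilter_none
    refine ⟨_, _, OrderType.type_eq_type.2 (type_leaves gA hSc hS),
      OrderType.type_eq_type.2 (type_leaves gB hTc hT), ?_⟩
    rintro _ ⟨⟨a, b⟩, ⟨ha, hb⟩, rfl⟩
    have hab : ¬ E (gA a) (gB b) := hST _ ha _ hb
    have h1 : c (a, b) ≠ 1 := fun h1 => hab ⟨a, b, rfl, rfl, h1⟩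
    rw [Set.mem_singleton_iff]
    lia
  · right
    simp only [CompleteFree, not_forall, not_exists, not_and, not_not] at h
    obtain ⟨P, Q, hP, hQ, hPQ⟩ := h
    refine ⟨{a | (gA a : Ordinal.{u}) ∈ P}, {b | (gB b : Ordinal.{u}) ∈ Q}, ?_, ?_, ?_⟩
    · refine type_preimage_finset gA P hP fun x hx => ?_
      -- As `Q` has as many elements as `P`, `x` has a neighbour in `Q`; this puts `x` in the range
      -- of `gA`, hence below `ω ^ ω`.
      obtain ⟨y₀, hy₀⟩ := Finset.card_pos.1 ((hP.trans hQ.symm) ▸ Finset.card_pos.2 ⟨x, hx⟩)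
      obtain ⟨a, -, rfl, -⟩ := hPQ x hx y₀ hy₀
      exact (gA a).2
    · refine type_preimage_finset gB Q hQ fun y hy => ?_
      obtain ⟨x₀, hx₀⟩ := Finset.card_pos.1 ((hQ.trans hP.symm) ▸ Finset.card_pos.2 ⟨y, hy⟩)
      obtain ⟨-, b, -, rfl, -⟩ := hPQ x₀ hx₀ y hy
      exact (gB b).2
    · rintro _ ⟨⟨a, b⟩, ⟨ha, hb⟩, rfl⟩
      obtain ⟨a', b', ha', hb', hc⟩ := hPQ _ ha _ hb
      obtain rfl : a' = a := gA.injective (Subtype.ext ha')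
      obtain rfl : b' = b := gB.injective (Subtype.ext hb')
      exact hc
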